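/- For $n\ge 2$, let $G'_{n-1}$ be any graph obtained from two disjoint balanced binary trees of height $n-1$ by adding the edges of a cycle that passes through all leaves of both trees exactly once and alternates between leaves of the left tree and leaves of the right tree. The root of the left tree is called ENTRANCE and the root of the right tree EXIT. The continuous-time quantum walk on a graph $G$ is the Schrödinger evolution $e^{-iHt}$ on the complex vector space with orthonormal basis $\{|a\rangle\}$ indexed by the vertices $a$ of $G$, where $H=\gamma A$, $A$ is the adjacency matrix of $G$ and $\gamma=1/\sqrt2$. There is an $N$ such that for every $n\ge N$, every such graph $G'_{n-1}$ and every $\varepsilon>0$: if the quantum walk on $G'_{n-1}$ is started at the ENTRANCE, run for a time $t$ chosen uniformly in $[0,\tau]$ with $\tau=\frac{n^4}{2\varepsilon}$, and then measured in the vertex basis, the probability of finding the EXIT is greater than $\frac{1}{2n}(1-\varepsilon)$, i.e. $$\frac1\tau\int_0^{\tau}\bigl|\langle \mathrm{EXIT}|e^{-iHt}|\mathrm{ENTRANCE}\rangle\bigr|^2\,dt>\frac{1}{2n}(1-\varepsilon).$$ -/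

import Mathlib

/-- Vertices of the balanced binary tree of height `h`: a level `k ∈ {0, …, h}` and a position among
the `2 ^ k` vertices of that level. -/
abbrev TreeNode (h : ℕ) : Type := Σ k : Fin (h + 1), Fin (2 ^ (k : ℕ))

/-- `u` is the parent of `v`: the children of position `i` on level `k` are the positions
`2 * i` and `2 * i + 1` on level `k + 1`. -/
def TreeNode.IsParent {h : ℕ} (u v : TreeNode h) : Prop :=
  (v.1 : ℕ) = (u.1 : ℕ) + 1 ∧ (v.2 : ℕ) / 2 = (u.2 : ℕ)

/-- The root, on level `0`. -/
def TreeNode.root (h : ℕ) : TreeNode h := ⟨0, 0, by simp⟩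

/-- The `2 ^ h` leaves, on level `h`. -/
def TreeNode.leaf (h : ℕ) (i : Fin (2 ^ h)) : TreeNode h := ⟨Fin.last h, i⟩

/-- Vertices of two disjoint binary trees of height `h` (left and right). -/
abbrev GluedVertex (h : ℕ) : Type := TreeNode h ⊕ TreeNode h

/-- The (oriented) edges. The leaf cycle visits, in this cyclic order, the leaves
`σ 0` (left), `ρ 0` (right), `σ 1` (left), `ρ 1` (right), …; thus the right leaf `ρ j` is joined to
the left leaves `σ j` and `σ (j + 1)`, where `j + 1` is the cyclic successor. -/
def gluedRel (h : ℕ) (σ ρ : Equiv.Perm (Fin (2 ^ h))) : GluedVertex h → GluedVertex h → Prop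
  | .inl u, .inl v => u.IsParent v
  | .inr u, .inr v => u.IsParent v
  | .inl u, .inr v => ∃ j : Fin (2 ^ h), v = TreeNode.leaf h (ρ j) ∧
      (u = TreeNode.leaf h (σ j) ∨ u = TreeNode.leaf h (σ (finRotate (2 ^ h) j)))
  | .inr _, .inl _ => False

/-- Two balanced binary trees of height `h` whose leaves are joined by the cycle that alternates
between left and right leaves and passes through them in the orders `σ` and `ρ`. Every alternating
cycle through all the leaves arises from some `σ` and `ρ`. -/
def gluedTrees (h : ℕ) (σ ρ : Equiv.Perm (Fin (2 ^ h))) : SimpleGraph (GluedVertex h) :=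
  SimpleGraph.fromRel (gluedRel h σ ρ)

/-- The root of the left tree. -/
def entranceVertex (h : ℕ) : GluedVertex h := .inl (TreeNode.root h)

/-- The root of the right tree. -/
def exitVertex (h : ℕ) : GluedVertex h := .inr (TreeNode.root h)

open Classical in
/-- The Hamiltonian of the continuous-time quantum walk on `G` with jump rate `γ`: `γ` times the
adjacency matrix. -/
noncomputable def walkHamiltonian {V : Type*} (G : SimpleGraph V) (γ : ℝ) : Matrix V V ℂ :=
  (γ : ℂ) • G.adjMatrix ℂ

open Classical in
/-- The state `exp (-i H t) |a⟩` at time `t` of the walk started at the vertex `a`. -/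
noncomputable def walkState {V : Type*} [Fintype V] (G : SimpleGraph V) (γ : ℝ) (a : V) (t : ℝ) :
    V → ℂ :=
  Matrix.mulVec (NormedSpace.exp ((-(Complex.I * (t : ℂ))) • walkHamiltonian G γ)) (Pi.single a 1)

/-- The probability of the outcome `b` when the walk on `G` is started at `a`, run for a time chosen
uniformly in `[0, τ]`, and then measured in the vertex basis. -/
noncomputable def walkHittingProb {V : Type*} [Fintype V] (G : SimpleGraph V) (γ : ℝ) (a b : V)
    (τ : ℝ) : ℝ :=
  (1 / τ) * ∫ t in (0 : ℝ)..τ, ‖walkState G γ a t b‖ ^ 2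

/-! The states uniform on each level of each tree span a subspace invariant under `H`, and in their
orthonormal basis `H` is a path on 2n vertices with all weights 1 except √2 on the middle edge,
whatever the gluing cycle. The amplitude from root to root is therefore a sum of 2n terms w_k
exp(-iE_k t) with w_k = ±φ_k(root)², where reflection parity gives the sign; hence ∑ |w_k| = 1. In
the time average the diagonal terms give ∑ w_k² ≥ 1/(2n) by Cauchy–Schwarz, and the others cost at
most 1/(τδ), where δ bounds the spacing of the E_k from below (`le_average_normSq_sum_exp`).

The heart is δ = 5/n³ (`IsSectorEigenvalue.gap`). On each half an eigenvector is a multiple of the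
Chebyshev-type sequence u = `jacobiSeq E`, and E satisfies u_{n+1} = ±√2 u_n. For opposite parities,
Christoffel–Darboux expresses E - F through the last entries u_n and the overlap of the two
sequences. For equal parities, orthogonality forces the quasi-momenta apart, and the cosine turns
this into a gap of order 1/n². Eigenvalues with |E| ≥ 2 are handled by growth and positivity of u.
-/

/-! ### Time averages of trigonometric sums. -/

open Complex in
theorem normSq_sum_exp {K : Type*} [Fintype K] (w E : K → ℝ) (t : ℝ) :
    ‖∑ k, (w k : ℂ) * exp (-(I * t) * E k)‖ ^ 2 =
      ∑ k, ∑ l, w k * w l * Real.cos ((E k - E l) * t) := by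
  have h : ((‖∑ k, (w k : ℂ) * exp (-(I * t) * E k)‖ ^ 2 : ℝ) : ℂ) =
      ∑ k, ∑ l, ((w k * w l : ℝ) : ℂ) * exp (((-((E k - E l) * t) : ℝ) : ℂ) * I) := by
    rw [Complex.ofReal_pow, ← Complex.mul_conj', map_sum, Finset.sum_mul_sum]
    refine Finset.sum_congr rfl fun k _ => Finset.sum_congr rfl fun l _ => ?_
    rw [map_mul, ← Complex.exp_conj, Complex.conj_ofReal]
    have : exp (((-((E k - E l) * t) : ℝ) : ℂ) * I) =
        exp (-(I * t) * E k) * exp ((starRingEnd ℂ) (-(I * t) * E l)) := by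
      rw [← Complex.exp_add]
      congr 1
      simp
      ring
    rw [this]
    push_cast
    ring
  have h' := congrArg Complex.re h
  rw [Complex.ofReal_re] at h'
  rw [h', Complex.re_sum]
  refine Finset.sum_congr rfl fun k _ => ?_
  rw [Complex.re_sum]
  refine Finset.sum_congr rfl fun l _ => ?_
  rw [Complex.re_ofReal_mul, Complex.exp_ofReal_mul_I_re, Real.cos_neg]

/-- The bound is independent of τ, so off-diagonal terms become negligible after division by τ. -/
theorem abs_integral_cos_mul_le {ω δ : ℝ} (hδ : 0 < δ) (h : δ ≤ |ω|) (τ : ℝ) :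
    |∫ t in (0 : ℝ)..τ, Real.cos (ω * t)| ≤ 1 / δ := by
  have hω : ω ≠ 0 := by
    rintro rfl
    simp at h
    linarith
  rw [intervalIntegral.integral_comp_mul_left (fun x => Real.cos x) hω]
  simp only [mul_zero, integral_cos, Real.sin_zero, sub_zero, smul_eq_mul, abs_mul, abs_inv]
  rw [← div_eq_inv_mul]
  exact div_le_div₀ zero_le_one (Real.abs_sin_le_one _) hδ h

/-- The long-time average of the square of an almost periodic sum with separated frequencies. -/
theorem le_average_normSq_sum_exp {K : Type*} [Fintype K] (w E : K → ℝ)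
    (hw : ∑ k, |w k| = 1) {δ τ : ℝ} (hδ : 0 < δ) (hτ : 0 < τ)
    (hE : ∀ k l, k ≠ l → δ ≤ |E k - E l|) :
    1 / (Fintype.card K : ℝ) - 1 / (τ * δ) ≤
      1 / τ * ∫ t in (0 : ℝ)..τ,
        ‖∑ k, (w k : ℂ) * Complex.exp (-(Complex.I * t) * E k)‖ ^ 2 := by
  classical
  simp only [normSq_sum_exp]
  have hint : (∫ t in (0 : ℝ)..τ, ∑ k, ∑ l, w k * w l * Real.cos ((E k - E l) * t)) =
      ∑ k, ∑ l, w k * w l * ∫ t in (0 : ℝ)..τ, Real.cos ((E k - E l) * t) := by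
    rw [intervalIntegral.integral_finsetSum]
    · refine Finset.sum_congr rfl fun k _ => ?_
      rw [intervalIntegral.integral_finsetSum]
      · simp only [intervalIntegral.integral_const_mul]
      · intro l _
        exact (by fun_prop : Continuous _).intervalIntegrable _ _
    · intro k _
      exact (by fun_prop : Continuous _).intervalIntegrable _ _
  rw [hint]
  -- The error is subtracted on the diagonal too, so that the errors add up to (∑ |w k|)² / δ = 1 /
  -- δ.
  have hterm : ∀ k l, (if k = l then w k ^ 2 * τ else 0) - |w k| * |w l| * (1 / δ) ≤
      w k * w l * ∫ t in (0 : ℝ)..τ, Real.cos ((E k - E l) * t) := by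
    intro k l
    by_cases hkl : k = l
    · subst hkl
      simp
      have : 0 ≤ w k * w k * δ⁻¹ := mul_nonneg (mul_self_nonneg _) (by positivity)
      nlinarith
    · rw [if_neg hkl, zero_sub]
      have h1 := abs_integral_cos_mul_le hδ (hE k l hkl) τ
      have h2 : |w k * w l * ∫ t in (0 : ℝ)..τ, Real.cos ((E k - E l) * t)| ≤
          |w k| * |w l| * (1 / δ) := by
        rw [abs_mul, abs_mul]
        gcongr
      exact (abs_le.mp h2).1
  have hsum := Finset.sum_le_sum fun k (_ : k ∈ Finset.univ) =>
    Finset.sum_le_sum fun l (_ : l ∈ Finset.univ) => hterm k l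
  have hleft : (∑ k, ∑ l, ((if k = l then w k ^ 2 * τ else 0) - |w k| * |w l| * (1 / δ))) =
      (∑ k, w k ^ 2) * τ - 1 / δ := by
    simp only [Finset.sum_sub_distrib, Finset.sum_ite_eq, Finset.mem_univ, if_true]
    rw [← Finset.sum_mul]
    congr 1
    simp only [← Finset.sum_mul]
    rw [← Finset.sum_mul_sum, hw]
    ring
  rw [hleft] at hsum
  have hcs : 1 / (Fintype.card K : ℝ) ≤ ∑ k, w k ^ 2 := by
    have h := sq_sum_le_card_mul_sum_sq (s := (Finset.univ : Finset K)) (f := fun k => |w k|)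
    simp only [hw, sq_abs, one_pow, Finset.card_univ] at h
    have hcard : (0 : ℝ) < Fintype.card K := by
      rcases (Nat.cast_nonneg (α := ℝ) (Fintype.card K)).eq_or_lt with h0 | h0
      · rw [← h0] at h
        linarith
      · exact h0
    rw [div_le_iff₀ hcard]
    linarith
  calc 1 / (Fintype.card K : ℝ) - 1 / (τ * δ) ≤ (∑ k, w k ^ 2) - 1 / (τ * δ) := by linarith
    _ = 1 / τ * ((∑ k, w k ^ 2) * τ - 1 / δ) := by field_simp
    _ ≤ _ := by gcongr

/-! ### The three-term recurrence. -/

/-- The solution of `u (j + 1) + u (j - 1) = E * u j` with `u 0 = 0` and `u 1 = 1`. -/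
def jacobiSeq (E : ℝ) : ℕ → ℝ
  | 0 => 0
  | 1 => 1
  | j + 2 => E * jacobiSeq E (j + 1) - jacobiSeq E j

theorem jacobiSeq_add_two (E : ℝ) (j : ℕ) :
    jacobiSeq E (j + 2) = E * jacobiSeq E (j + 1) - jacobiSeq E j := rfl

theorem jacobiSeq_neg (E : ℝ) (j : ℕ) : jacobiSeq (-E) j = (-1) ^ (j + 1) * jacobiSeq E j := by
  induction j using Nat.twoStepInduction with
  | zero => simp [jacobiSeq]
  | one => simp [jacobiSeq]
  | more j ih1 ih2 =>
    rw [jacobiSeq_add_two, jacobiSeq_add_two, ih1, ih2]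
    ring

/-- This quadratic form is conserved by the recurrence. In particular two consecutive terms never
vanish together. -/
theorem jacobiSeq_energy (E : ℝ) (j : ℕ) :
    jacobiSeq E (j + 1) ^ 2 + jacobiSeq E j ^ 2 - E * jacobiSeq E j * jacobiSeq E (j + 1) = 1 := by
  induction j with
  | zero => simp [jacobiSeq]
  | succ j ih =>
    rw [jacobiSeq_add_two]
    linear_combination ih

theorem jacobiSeq_christoffel_darboux (E F : ℝ) (n : ℕ) :
    (E - F) * ∑ j ∈ Finset.range n, jacobiSeq E (j + 1) * jacobiSeq F (j + 1) =
      jacobiSeq E (n + 1) * jacobiSeq F n - jacobiSeq E n * jacobiSeq F (n + 1) := by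
  induction n with
  | zero => simp [jacobiSeq]
  | succ n ih =>
    rw [Finset.sum_range_succ, mul_add, ih, jacobiSeq_add_two, jacobiSeq_add_two]
    ring

/-- The increments of the two sides agree exactly because of `jacobiSeq_energy`. -/
theorem jacobiSeq_sum_sq (E : ℝ) (n : ℕ) :
    (4 - E ^ 2) / 2 * ∑ j ∈ Finset.range n, jacobiSeq E (j + 1) ^ 2 =
      n + jacobiSeq E n ^ 2 - E / 2 * jacobiSeq E n * jacobiSeq E (n + 1) := by
  induction n with
  | zero => simp [jacobiSeq]
  | succ n ih =>
    rw [Finset.sum_range_succ, mul_add, ih, jacobiSeq_add_two]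
    push_cast
    linear_combination jacobiSeq_energy E n

/-- For E ≥ 2 and nonnegative terms the recurrence is convex, so the increments never drop below the
first one, which is 1. -/
theorem jacobiSeq_growth {E : ℝ} (hE : 2 ≤ E) (j : ℕ) :
    (j : ℝ) ≤ jacobiSeq E j ∧ jacobiSeq E j + 1 ≤ jacobiSeq E (j + 1) := by
  induction j with
  | zero => simp [jacobiSeq]
  | succ j ih =>
    rw [jacobiSeq_add_two]
    push_cast
    have h0 : (0 : ℝ) ≤ j := Nat.cast_nonneg j
    constructor
    · linarith
    · nlinarith [mul_nonneg (sub_nonneg.mpr hE) (by linarith : 0 ≤ jacobiSeq E (j + 1))]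

theorem jacobiSeq_two_mul_cos (p : ℝ) (j : ℕ) :
    jacobiSeq (2 * Real.cos p) j * Real.sin p = Real.sin (j * p) := by
  induction j using Nat.twoStepInduction with
  | zero => simp [jacobiSeq]
  | one => simp [jacobiSeq]
  | more j ih1 ih2 =>
    rw [jacobiSeq_add_two, sub_mul, mul_assoc, ih1, ih2]
    push_cast
    have h1 : ((j : ℝ) + 2) * p = (j + 1) * p + p := by ring
    have h2 : (j : ℝ) * p = (j + 1) * p - p := by ring
    rw [h1, h2, Real.sin_add, Real.sin_sub]
    ring

/-! ### Consequences of the boundary condition. -/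

/-- `E` is an eigenvalue of the half path of length `n` in the sector of reflection parity `s`. -/
structure IsSectorEigenvalue (n : ℕ) (s E : ℝ) : Prop where
  parity : s = 1 ∨ s = -1
  boundary : jacobiSeq E (n + 1) = s * √2 * jacobiSeq E n

namespace IsSectorEigenvalue

variable {n : ℕ} {s E s' F : ℝ}

/-- The path is bipartite; this transfers results at the upper band edge to the lower one. -/
theorem neg (h : IsSectorEigenvalue n s E) : IsSectorEigenvalue n (-s) (-E) := by
  refine ⟨?_, ?_⟩
  · rcases h.parity with h | h <;> simp [h]
  · rw [jacobiSeq_neg, jacobiSeq_neg, h.boundary]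
    ring

theorem sq_parity (h : IsSectorEigenvalue n s E) : s ^ 2 = 1 := by
  rcases h.parity with h | h <;> simp [h]

/-- Inserting the boundary condition into the conserved form determines the last entry up to sign.
-/
theorem sq_mul_eq_one (h : IsSectorEigenvalue n s E) :
    jacobiSeq E n ^ 2 * (3 - s * √2 * E) = 1 := by
  have h1 := jacobiSeq_energy E n
  rw [h.boundary] at h1
  have h2 : (√2) ^ 2 = 2 := Real.sq_sqrt (by norm_num)
  linear_combination h1 - s ^ 2 * jacobiSeq E n ^ 2 * h2 - 2 * jacobiSeq E n ^ 2 * h.sq_parity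

theorem sum_sq (h : IsSectorEigenvalue n s E) :
    (4 - E ^ 2) / 2 * ∑ j ∈ Finset.range n, jacobiSeq E (j + 1) ^ 2 =
      n + (1 - s * √2 * E / 2) * jacobiSeq E n ^ 2 := by
  rw [jacobiSeq_sum_sq, h.boundary]
  ring

theorem sum_sq_le (h : IsSectorEigenvalue n s E) :
    (4 - E ^ 2) / 2 * ∑ j ∈ Finset.range n, jacobiSeq E (j + 1) ^ 2 ≤ n + 1 / 2 := by
  rw [h.sum_sq]
  nlinarith [h.sq_mul_eq_one, sq_nonneg (jacobiSeq E n)]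

/-- By `sq_mul_eq_one` the correction to n equals (1 - u_n²)/2, and 3 - s√2E ≥ 0.17 in the band
keeps u_n² below 6. -/
theorem le_sum_sq (h : IsSectorEigenvalue n s E) (hE : |E| < 2) :
    (n : ℝ) - 3 ≤ (4 - E ^ 2) / 2 * ∑ j ∈ Finset.range n, jacobiSeq E (j + 1) ^ 2 := by
  rw [h.sum_sq]
  have h1 := h.sq_mul_eq_one
  have h2 := sq_nonneg (jacobiSeq E n)
  have hr : (√2) ^ 2 = 2 := Real.sq_sqrt (by norm_num)
  have hr0 : 0 ≤ √2 := Real.sqrt_nonneg 2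
  have hr2 : √2 < 1.415 := by nlinarith
  obtain ⟨ha, hb⟩ := abs_lt.mp hE
  have h3 : s * √2 * E ≤ 2.83 := by
    rcases h.parity with h | h <;> rw [h] <;> nlinarith
  nlinarith

/-- Growth excludes s = -1 by sign. It also makes u_n² ≥ 36, so 3 - √2E = 1/u_n² is small and E is
close to 3/√2 ≈ 2.12, detached from the band. -/
theorem outside_band (h : IsSectorEigenvalue n s E) (hn : 6 ≤ n) (hE : 2 ≤ E) :
    s = 1 ∧ 2.1 ≤ E := by
  have hn' : (6 : ℝ) ≤ n := by exact_mod_cast hn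
  obtain ⟨h1, h2⟩ := jacobiSeq_growth hE n
  have hr : (√2) ^ 2 = 2 := Real.sq_sqrt (by norm_num)
  have hr0 : 0 ≤ √2 := Real.sqrt_nonneg 2
  have hr2 : √2 < 1.415 := by nlinarith
  have hs : s = 1 := by
    rcases h.parity with hs | hs
    · exact hs
    · have := h.boundary
      rw [hs] at this
      nlinarith
  refine ⟨hs, ?_⟩
  have h3 := h.sq_mul_eq_one
  rw [hs] at h3
  have h4 : (36 : ℝ) ≤ jacobiSeq E n ^ 2 := by nlinarith
  have h5 : 3 - 1 * √2 * E ≤ 1 / 36 := by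
    by_contra! hlt
    nlinarith
  nlinarith

end IsSectorEigenvalue

/-! ### Separation of the eigenvalues. -/

namespace IsSectorEigenvalue

variable {n : ℕ} {s E s' F : ℝ}

/-- With E = 2 cos p the boundary condition reads sin((n+1)p) = s√2 sin(np). If p ≤ π/(n+1),
concavity of the sine gives sin(np) ≥ n/(n+1) · sin((n+1)p), which contradicts the factor √2 since
√2 · 3/4 > 1; s = -1 fails by sign. -/
theorem lt_two_mul_cos (h : IsSectorEigenvalue n s E) (hn : 3 ≤ n) (hE : |E| < 2) :
    E < 2 * Real.cos (Real.pi / (n + 1)) := by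
  obtain ⟨ha, hb⟩ := abs_lt.mp hE
  have hn' : (3 : ℝ) ≤ n := by exact_mod_cast hn
  set p := Real.arccos (E / 2) with hp
  have hcos : Real.cos p = E / 2 := Real.cos_arccos (by linarith) (by linarith)
  have hEp : E = 2 * Real.cos p := by rw [hcos]; ring
  have hp0 : 0 < p := Real.arccos_pos.mpr (by linarith)
  by_contra! hcon
  have hpi := Real.pi_pos
  have hle : p ≤ Real.pi / (n + 1) := by
    by_contra! hlt
    have := Real.cos_lt_cos_of_nonneg_of_le_pi (by positivity) (Real.arccos_le_pi _) hlt
    rw [← hp] at this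
    linarith
  rw [le_div_iff₀ (by positivity)] at hle
  have h1 := jacobiSeq_two_mul_cos p n
  have h2 := jacobiSeq_two_mul_cos p (n + 1)
  rw [← hEp] at h1 h2
  rw [h.boundary, mul_assoc, h1] at h2
  push_cast at h2
  have hpos : 0 < Real.sin (n * p) :=
    Real.sin_pos_of_pos_of_lt_pi (by positivity) (by nlinarith)
  have hnn : 0 ≤ Real.sin ((n + 1) * p) :=
    Real.sin_nonneg_of_nonneg_of_le_pi (by positivity) (by linarith)
  have hr : (√2) ^ 2 = 2 := Real.sq_sqrt (by norm_num)
  have hr0 : 0 ≤ √2 := Real.sqrt_nonneg 2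
  have hr2 : 1.4 < √2 := by nlinarith
  have hconc := strictConcaveOn_sin_Icc.concaveOn.2
    (show (0 : ℝ) ∈ Set.Icc 0 Real.pi from ⟨le_rfl, hpi.le⟩)
    (show ((n : ℝ) + 1) * p ∈ Set.Icc 0 Real.pi from ⟨by positivity, by linarith⟩)
    (show (0 : ℝ) ≤ 1 / (n + 1) by positivity) (show (0 : ℝ) ≤ n / (n + 1) by positivity)
    (by field_simp; ring)
  simp only [smul_eq_mul, mul_zero, Real.sin_zero, zero_add] at hconc
  rw [show (n : ℝ) / (n + 1) * ((n + 1) * p) = n * p by field_simp, div_mul_eq_mul_div,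
    div_le_iff₀ (by positivity), ← h2] at hconc
  rcases h.parity with hs | hs <;> rw [hs] at h2 hconc
  · nlinarith [mul_pos hpos (by linarith : (0 : ℝ) < √2 - 1.4)]
  · nlinarith

/-- Eigenvalues inside the band stay away from its edges. -/
theorem le_four_sub_sq (h : IsSectorEigenvalue n s E) (hn : 3 ≤ n) (hE : |E| < 2) :
    16 / ((n : ℝ) + 1) ^ 2 ≤ 4 - E ^ 2 := by
  have h1 := h.lt_two_mul_cos hn hE
  have h2 := h.neg.lt_two_mul_cos hn (by rwa [abs_neg])
  have hn' : (3 : ℝ) ≤ n := by exact_mod_cast hn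
  have hpi := Real.pi_pos
  have h3 := Real.mul_le_sin (x := Real.pi / (n + 1)) (by positivity)
    (by gcongr; linarith)
  rw [show 2 / Real.pi * (Real.pi / ((n : ℝ) + 1)) = 2 / (n + 1) by field_simp] at h3
  have h4 : (2 / ((n : ℝ) + 1)) ^ 2 ≤ Real.sin (Real.pi / (n + 1)) ^ 2 := by gcongr
  rw [Real.sin_sq] at h4
  have h5 : E ^ 2 ≤ (2 * Real.cos (Real.pi / (n + 1))) ^ 2 :=
    sq_le_sq' (by linarith) h1.le
  calc 16 / ((n : ℝ) + 1) ^ 2 = 4 * (2 / ((n : ℝ) + 1)) ^ 2 := by rw [div_pow]; ring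
    _ ≤ 4 - E ^ 2 := by linarith

/-- With opposite boundary conditions, Christoffel–Darboux becomes (E - F) C = 2s√2 ab, where C is
the overlap and a, b are the last entries. Here C² ≤ AB is at most of order n⁶ by `sum_sq_le` and
`le_four_sub_sq`, while ab is bounded below by `sq_mul_eq_one`. -/
theorem gap_of_opposite_parity_of_abs_lt (h : IsSectorEigenvalue n s E)
    (h' : IsSectorEigenvalue n (-s) F) (hn : 100 ≤ n) (hE : |E| < 2) (hF : |F| < 2) :
    5 / (n : ℝ) ^ 3 ≤ |E - F| := by
  by_contra! hlt
  have hn' : (100 : ℝ) ≤ n := by exact_mod_cast hn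
  have hr : (√2) ^ 2 = 2 := Real.sq_sqrt (by norm_num)
  have hr0 : 0 ≤ √2 := Real.sqrt_nonneg 2
  have hr2 : √2 < 1.415 := by nlinarith
  have hr1 : 1.414 < √2 := by nlinarith
  have hcd := jacobiSeq_christoffel_darboux E F n
  rw [h.boundary, h'.boundary] at hcd
  have hcs := Finset.sum_mul_sq_le_sq_mul_sq (Finset.range n)
    (fun j => jacobiSeq E (j + 1)) (fun j => jacobiSeq F (j + 1))
  have hu := h.sq_mul_eq_one
  have hv := h'.sq_mul_eq_one
  have hSu := h.sum_sq_le
  have hSv := h'.sum_sq_le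
  have hDu := h.le_four_sub_sq (by omega) hE
  have hDv := h'.le_four_sub_sq (by omega) hF
  have hs := h.sq_parity
  set A := ∑ j ∈ Finset.range n, jacobiSeq E (j + 1) ^ 2
  set B := ∑ j ∈ Finset.range n, jacobiSeq F (j + 1) ^ 2
  set C := ∑ j ∈ Finset.range n, jacobiSeq E (j + 1) * jacobiSeq F (j + 1)
  set a := jacobiSeq E n
  set b := jacobiSeq F n
  have hA0 : 0 ≤ A := Finset.sum_nonneg fun j _ => sq_nonneg _
  have hB0 : 0 ≤ B := Finset.sum_nonneg fun j _ => sq_nonneg _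
  have hsmall : |E - F| < 0.01 := by
    refine hlt.trans_le ?_
    rw [div_le_iff₀ (by positivity)]
    have : (100 : ℝ) ^ 3 ≤ (n : ℝ) ^ 3 := by gcongr
    linarith
  obtain ⟨hs1, hs2⟩ := abs_lt.mp hsmall
  -- As E and F nearly coincide, the product is about 9 - 2EF, and EF cannot be appreciably
  -- negative.
  have hprod : (3 - s * √2 * E) * (3 - -s * √2 * F) ≤ 10 := by
    have : (3 - s * √2 * E) * (3 - -s * √2 * F) =
        9 - 3 * √2 * (s * (E - F)) - s ^ 2 * (√2) ^ 2 * (E * F) := by ring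
    rw [this, hs, hr]
    have h1 : -0.01 ≤ s * (E - F) := by
      rcases h.parity with h | h <;> rw [h] <;> linarith
    have h2 : -0.01 ≤ E * F := by nlinarith [sq_nonneg (E + F)]
    nlinarith
  have hab : 1 ≤ 10 * (a ^ 2 * b ^ 2) := by
    have h0 : 0 ≤ a ^ 2 * b ^ 2 := by positivity
    calc (1 : ℝ) = (a ^ 2 * b ^ 2) * ((3 - s * √2 * E) * (3 - -s * √2 * F)) := by
          linear_combination -hv - (b ^ 2 * (3 - -s * √2 * F)) * hu
      _ ≤ (a ^ 2 * b ^ 2) * 10 := by gcongr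
      _ = _ := by ring
  have hgap : 8 * (a ^ 2 * b ^ 2) ≤ (E - F) ^ 2 * (A * B) := by
    have h1 : (E - F) ^ 2 * C ^ 2 = 8 * (a ^ 2 * b ^ 2) := by
      have : (E - F) * C = 2 * s * √2 * (a * b) := by rw [hcd]; ring
      rw [← mul_pow, this]
      linear_combination (4 * s ^ 2 * (a * b) ^ 2) * hr + (8 * (a * b) ^ 2) * hs
    rw [← h1]
    gcongr
  have hAB : 16 / ((n : ℝ) + 1) ^ 2 / 2 * A * (16 / ((n : ℝ) + 1) ^ 2 / 2 * B) ≤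
      (n + 1 / 2) * (n + 1 / 2) := by
    have h1 : 16 / ((n : ℝ) + 1) ^ 2 / 2 * A ≤ n + 1 / 2 := le_trans (by gcongr) hSu
    have h2 : 16 / ((n : ℝ) + 1) ^ 2 / 2 * B ≤ n + 1 / 2 := le_trans (by gcongr) hSv
    gcongr
  have hAB' : 64 * (A * B) ≤ ((n : ℝ) + 1) ^ 6 := by
    have h1 : 16 / ((n : ℝ) + 1) ^ 2 / 2 * A * (16 / ((n : ℝ) + 1) ^ 2 / 2 * B) =
        64 * (A * B) / ((n : ℝ) + 1) ^ 4 := by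
      field_simp
      ring
    rw [h1, div_le_iff₀ (by positivity)] at hAB
    calc _ ≤ _ := hAB
      _ ≤ ((n + 1) * (n + 1)) * ((n : ℝ) + 1) ^ 4 := by gcongr <;> norm_num
      _ = _ := by ring
  have hsq : (E - F) ^ 2 ≤ 25 / (n : ℝ) ^ 6 := by
    rw [← sq_abs]
    calc |E - F| ^ 2 ≤ (5 / (n : ℝ) ^ 3) ^ 2 := by gcongr
      _ = _ := by ring
  have hpow : ((n : ℝ) + 1) ^ 6 ≤ 2 * (n : ℝ) ^ 6 := by
    calc ((n : ℝ) + 1) ^ 6 ≤ (1.01 * n) ^ 6 := by gcongr; linarith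
      _ = 1.01 ^ 6 * (n : ℝ) ^ 6 := by ring
      _ ≤ _ := by gcongr; norm_num
  -- This contradicts `hab` and `hgap`, which make the same quantity at least 8/10.
  have hfin : (E - F) ^ 2 * (A * B) ≤ 25 / 32 := by
    calc (E - F) ^ 2 * (A * B) ≤ 25 / (n : ℝ) ^ 6 * (2 * (n : ℝ) ^ 6 / 64) := by
          gcongr
          linarith
      _ = _ := by field_simp; norm_num
  linarith

/-- In the product formula for a difference of cosines both sines are at least (p - q)/π in the case
q ≤ p: the first by Jordan's inequality, the second because it dominates the first. -/
theorem two_mul_sq_le_abs_cos_sub_cos {p q : ℝ} (hp0 : 0 ≤ p) (hpπ : p ≤ Real.pi)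
    (hq0 : 0 ≤ q) (hqπ : q ≤ Real.pi) :
    2 * ((p - q) / Real.pi) ^ 2 ≤ |Real.cos p - Real.cos q| := by
  wlog hpq : q ≤ p generalizing p q
  · have := this hq0 hqπ hp0 hpπ (by linarith)
    rw [abs_sub_comm]
    convert this using 1
    ring
  have hpi := Real.pi_pos
  have h1 := Real.mul_le_sin (x := (p - q) / 2) (by linarith) (by linarith)
  have h2 : Real.sin ((p - q) / 2) ≤ Real.sin ((p + q) / 2) := by
    rcases le_total ((p + q) / 2) (Real.pi / 2) with hle | hle
    · exact Real.sin_le_sin_of_le_of_le_pi_div_two (by linarith) hle (by linarith)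
    · rw [← Real.sin_pi_sub ((p + q) / 2)]
      exact Real.sin_le_sin_of_le_of_le_pi_div_two (by linarith) (by linarith) (by linarith)
  have h0 : 0 ≤ (p - q) / Real.pi := div_nonneg (by linarith) hpi.le
  rw [show 2 / Real.pi * ((p - q) / 2) = (p - q) / Real.pi by ring] at h1
  rw [Real.cos_sub_cos, abs_mul, abs_mul, abs_of_nonneg (h0.trans h1),
    abs_of_nonneg ((h0.trans h1).trans h2)]
  norm_num
  nlinarith [mul_le_mul h1 (h1.trans h2) h0 (h0.trans h1)]

theorem sum_sin_sq (p : ℝ) (n : ℕ) :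
    ∑ j ∈ Finset.range n, Real.sin (((j : ℝ) + 1) * p) ^ 2 =
      1 / 2 * ((4 - (2 * Real.cos p) ^ 2) / 2 *
        ∑ j ∈ Finset.range n, jacobiSeq (2 * Real.cos p) (j + 1) ^ 2) := by
  rw [← mul_assoc, Finset.mul_sum]
  refine Finset.sum_congr rfl fun j _ => ?_
  have := jacobiSeq_two_mul_cos p (j + 1)
  push_cast at this
  rw [← this]
  linear_combination (jacobiSeq (2 * Real.cos p) (j + 1) ^ 2) * Real.sin_sq_add_cos_sq p

/-- The vectors sin(jp) and sin(jq) are orthogonal with squared norms at least (n - 3)/2, so their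
squared distance is at least n - 3. The sine being 1-Lipschitz, it is also at most n(n|p - q|)²,
whence |p - q| is at least of order 1/n. -/
theorem gap_of_orthogonal_of_abs_lt (h : IsSectorEigenvalue n s E)
    (h' : IsSectorEigenvalue n s F) (hn : 100 ≤ n) (hE : |E| < 2) (hF : |F| < 2)
    (horth : ∑ j ∈ Finset.range n, jacobiSeq E (j + 1) * jacobiSeq F (j + 1) = 0) :
    5 / (n : ℝ) ^ 3 ≤ |E - F| := by
  have hn' : (100 : ℝ) ≤ n := by exact_mod_cast hn
  obtain ⟨p, ⟨hp0, hpπ⟩, rfl⟩ : ∃ p, (0 ≤ p ∧ p ≤ Real.pi) ∧ 2 * Real.cos p = E := by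
    obtain ⟨ha, hb⟩ := abs_lt.mp hE
    refine ⟨Real.arccos (E / 2), ⟨Real.arccos_nonneg _, Real.arccos_le_pi _⟩, ?_⟩
    rw [Real.cos_arccos (by linarith) (by linarith)]
    ring
  obtain ⟨q, ⟨hq0, hqπ⟩, rfl⟩ : ∃ q, (0 ≤ q ∧ q ≤ Real.pi) ∧ 2 * Real.cos q = F := by
    obtain ⟨ha, hb⟩ := abs_lt.mp hF
    refine ⟨Real.arccos (F / 2), ⟨Real.arccos_nonneg _, Real.arccos_le_pi _⟩, ?_⟩
    rw [Real.cos_arccos (by linarith) (by linarith)]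
    ring
  have hnp := h.le_sum_sq hE
  have hnq := h'.le_sum_sq hF
  have horth' : ∑ j ∈ Finset.range n,
      Real.sin (((j : ℝ) + 1) * p) * Real.sin (((j : ℝ) + 1) * q) = 0 := by
    have : ∀ j ∈ Finset.range n, Real.sin (((j : ℝ) + 1) * p) * Real.sin (((j : ℝ) + 1) * q) =
        Real.sin p * Real.sin q *
          (jacobiSeq (2 * Real.cos p) (j + 1) * jacobiSeq (2 * Real.cos q) (j + 1)) := by
      intro j _
      have h1 := jacobiSeq_two_mul_cos p (j + 1)
      have h2 := jacobiSeq_two_mul_cos q (j + 1)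
      push_cast at h1 h2
      rw [← h1, ← h2]
      ring
    rw [Finset.sum_congr rfl this, ← Finset.mul_sum, horth, mul_zero]
  have hdist : (n : ℝ) - 3 ≤ ∑ j ∈ Finset.range n,
      (Real.sin (((j : ℝ) + 1) * p) - Real.sin (((j : ℝ) + 1) * q)) ^ 2 := by
    have : ∀ j ∈ Finset.range n,
        (Real.sin (((j : ℝ) + 1) * p) - Real.sin (((j : ℝ) + 1) * q)) ^ 2 =
        Real.sin (((j : ℝ) + 1) * p) ^ 2 + Real.sin (((j : ℝ) + 1) * q) ^ 2 -
          2 * (Real.sin (((j : ℝ) + 1) * p) * Real.sin (((j : ℝ) + 1) * q)) := by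
      intro j _
      ring
    rw [Finset.sum_congr rfl this, Finset.sum_sub_distrib, Finset.sum_add_distrib,
      ← Finset.mul_sum, horth', sum_sin_sq, sum_sin_sq]
    linarith
  have hub : ∑ j ∈ Finset.range n,
      (Real.sin (((j : ℝ) + 1) * p) - Real.sin (((j : ℝ) + 1) * q)) ^ 2 ≤
        n * (n * |p - q|) ^ 2 := by
    have : ∀ j ∈ Finset.range n,
        (Real.sin (((j : ℝ) + 1) * p) - Real.sin (((j : ℝ) + 1) * q)) ^ 2 ≤
          (n * |p - q|) ^ 2 := by
      intro j hj
      have hj' : (j : ℝ) + 1 ≤ n := by exact_mod_cast Finset.mem_range.mp hj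
      rw [← sq_abs]
      gcongr
      have h1 : |Real.sin (((j : ℝ) + 1) * p) - Real.sin (((j : ℝ) + 1) * q)| ≤
          |((j : ℝ) + 1) * p - ((j : ℝ) + 1) * q| := Real.abs_sin_sub_sin_le _ _
      rw [← mul_sub, abs_mul, abs_of_nonneg (by positivity : (0 : ℝ) ≤ j + 1)] at h1
      exact h1.trans (by gcongr)
    simpa using Finset.sum_le_card_nsmul _ _ _ this
  have hd : 1 / 2 ≤ (n * |p - q|) ^ 2 := by
    by_contra! hlt
    nlinarith
  have hcos := two_mul_sq_le_abs_cos_sub_cos hp0 hpπ hq0 hqπ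
  have hpi : Real.pi ^ 2 < 10 := by nlinarith [Real.pi_lt_d2, Real.pi_pos]
  rw [← mul_sub, abs_mul, abs_two]
  calc 5 / (n : ℝ) ^ 3 ≤ 1 / (5 * n ^ 2) := by
        rw [div_le_div_iff₀ (by positivity) (by positivity)]
        nlinarith [mul_nonneg (sq_nonneg (n : ℝ)) (by linarith : (0 : ℝ) ≤ n - 25)]
    _ ≤ 4 / (10 * n ^ 2) * (n * |p - q|) ^ 2 := by
        calc 1 / (5 * (n : ℝ) ^ 2) = 4 / (10 * n ^ 2) * (1 / 2) := by field_simp; norm_num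
          _ ≤ _ := by gcongr
    _ = 4 * (p - q) ^ 2 / 10 := by rw [mul_pow, sq_abs]; field_simp
    _ ≤ 4 * (p - q) ^ 2 / Real.pi ^ 2 := by gcongr
    _ = 2 * (2 * ((p - q) / Real.pi) ^ 2) := by rw [div_pow]; ring
    _ ≤ _ := by gcongr

/-- An eigenvalue `E ≥ 2` can be close to another one only if the parities agree and the
eigenvectors are not orthogonal. -/
theorem parity_eq_and_sum_pos_of_two_le (h : IsSectorEigenvalue n s E) (h' : IsSectorEigenvalue n s' F)
    (hn : 100 ≤ n) (hE : 2 ≤ E) (hlt : |E - F| < 5 / (n : ℝ) ^ 3) :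
    s = s' ∧ 0 < ∑ j ∈ Finset.range n, jacobiSeq E (j + 1) * jacobiSeq F (j + 1) := by
  have hn' : (100 : ℝ) ≤ n := by exact_mod_cast hn
  obtain ⟨hs, hE'⟩ := h.outside_band (by omega) hE
  have hsmall : |E - F| < 0.01 := by
    refine hlt.trans_le ?_
    rw [div_le_iff₀ (by positivity)]
    have : (100 : ℝ) ^ 3 ≤ (n : ℝ) ^ 3 := by gcongr
    linarith
  have hF : 2 ≤ F := by
    have := (abs_lt.mp hsmall).2
    linarith
  refine ⟨hs.trans (h'.outside_band (by omega) hF).1.symm, ?_⟩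
  refine Finset.sum_pos (fun j _ => ?_) ⟨0, Finset.mem_range.mpr (by omega)⟩
  have h1 := (jacobiSeq_growth hE (j + 1)).1
  have h2 := (jacobiSeq_growth hF (j + 1)).1
  have h0 : (0 : ℝ) < ((j + 1 : ℕ) : ℝ) := by positivity
  exact mul_pos (h0.trans_le h1) (h0.trans_le h2)

theorem parity_eq_and_sum_pos_of_two_le_abs (h : IsSectorEigenvalue n s E) (h' : IsSectorEigenvalue n s' F)
    (hn : 100 ≤ n) (hE : 2 ≤ |E|) (hlt : |E - F| < 5 / (n : ℝ) ^ 3) :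
    s = s' ∧ 0 < ∑ j ∈ Finset.range n, jacobiSeq E (j + 1) * jacobiSeq F (j + 1) := by
  rcases le_abs.mp hE with hE | hE
  · exact h.parity_eq_and_sum_pos_of_two_le h' hn hE hlt
  · obtain ⟨h1, h2⟩ := h.neg.parity_eq_and_sum_pos_of_two_le h'.neg hn hE
      (by rwa [neg_sub_neg, abs_sub_comm])
    refine ⟨neg_injective h1, ?_⟩
    convert h2 using 2 with j _
    rw [jacobiSeq_neg, jacobiSeq_neg, mul_mul_mul_comm, ← mul_pow]
    simp

/-- Distinct eigenvalues of the two sectors are polynomially separated. -/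
theorem gap (h : IsSectorEigenvalue n s E) (h' : IsSectorEigenvalue n s' F) (hn : 100 ≤ n)
    (horth : s = s' →
      ∑ j ∈ Finset.range n, jacobiSeq E (j + 1) * jacobiSeq F (j + 1) = 0) :
    5 / (n : ℝ) ^ 3 ≤ |E - F| := by
  by_contra! hlt
  have hE : |E| < 2 := by
    by_contra! hE
    obtain ⟨h1, h2⟩ := h.parity_eq_and_sum_pos_of_two_le_abs h' hn hE hlt
    exact h2.ne' (horth h1)
  have hF : |F| < 2 := by
    by_contra! hF
    obtain ⟨h1, h2⟩ := h'.parity_eq_and_sum_pos_of_two_le_abs h hn hF (by rwa [abs_sub_comm])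
    simp only [mul_comm (jacobiSeq F _)] at h2
    exact h2.ne' (horth h1.symm)
  by_cases hs : s = s'
  · subst hs
    exact absurd (h.gap_of_orthogonal_of_abs_lt h' hn hE hF (horth rfl)) hlt.not_ge
  · have hs' : s' = -s := by
      rcases h.parity with h1 | h1 <;> rcases h'.parity with h2 | h2 <;>
        simp_all
    subst hs'
    exact absurd (h.gap_of_opposite_parity_of_abs_lt h' hn hE hF) hlt.not_ge

end IsSectorEigenvalue

/-! ### Reduction to the column subspace. -/

/-- The columns of the glued trees: a side and a level. -/
abbrev Column (h : ℕ) : Type := Fin (h + 1) ⊕ Fin (h + 1)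

/-- The column of a vertex. -/
def GluedVertex.column {h : ℕ} : GluedVertex h → Column h :=
  Sum.map Sigma.fst Sigma.fst

/-- The distance of a column from the root of its tree. -/
def Column.level {h : ℕ} : Column h → ℕ :=
  Sum.elim (fun k => k) (fun k => k)

/-- Adjacency of consecutive levels. -/
def levelWeight {h : ℕ} (k l : Fin (h + 1)) : ℝ :=
  if (l : ℕ) = k + 1 ∨ (k : ℕ) = l + 1 then 1 else 0

/-- The matrix of the walk on the column subspace in its orthonormal basis. -/
noncomputable def columnMatrix (h : ℕ) : Matrix (Column h) (Column h) ℝ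
  | .inl k, .inl l => levelWeight k l
  | .inr k, .inr l => levelWeight k l
  | .inl k, .inr l => if k = Fin.last h ∧ l = Fin.last h then √2 else 0
  | .inr k, .inl l => if k = Fin.last h ∧ l = Fin.last h then √2 else 0

theorem levelWeight_comm {h : ℕ} (k l : Fin (h + 1)) : levelWeight k l = levelWeight l k := by
  simp only [levelWeight, or_comm]

theorem columnMatrix_isHermitian (h : ℕ) : (columnMatrix h).IsHermitian := by
  refine Matrix.IsHermitian.ext fun c d => ?_
  rcases c with k | k <;> rcases d with l | l <;>
    simp [columnMatrix, levelWeight_comm k l, and_comm]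

/-- The state which is uniform on each column, with the given amplitudes in the orthonormal basis
of column states. -/
noncomputable def columnLift {h : ℕ} (φ : Column h → ℝ) (x : GluedVertex h) : ℂ :=
  ((φ x.column / √2 ^ x.column.level : ℝ) : ℂ)

open Classical in
theorem sum_isParent {h : ℕ} (x : TreeNode h) (k : Fin (h + 1)) :
    (∑ i : Fin (2 ^ (k : ℕ)), if x.IsParent ⟨k, i⟩ then (1 : ℝ) else 0) =
      if (k : ℕ) = x.1 + 1 then 2 else 0 := by
  obtain ⟨l, i⟩ := x
  split_ifs with hk
  · change (k : ℕ) = l + 1 at hk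
    have hi := i.2
    have h2 : 2 ^ (k : ℕ) = 2 * 2 ^ (l : ℕ) := by rw [hk, pow_succ]; ring
    have ha : 2 * (i : ℕ) < 2 ^ (k : ℕ) := by omega
    have hb : 2 * (i : ℕ) + 1 < 2 ^ (k : ℕ) := by omega
    rw [← Finset.sum_filter]
    have : (Finset.univ.filter fun j : Fin (2 ^ (k : ℕ)) =>
        TreeNode.IsParent ⟨l, i⟩ ⟨k, j⟩) = {⟨2 * i, ha⟩, ⟨2 * i + 1, hb⟩} := by
      ext j
      simp only [Finset.mem_filter, Finset.mem_univ, true_and, Finset.mem_insert,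
        Finset.mem_singleton, Fin.ext_iff]
      change ((k : ℕ) = l + 1 ∧ (j : ℕ) / 2 = i) ↔ _
      omega
    rw [this, Finset.sum_pair (by simp [Fin.ext_iff])]
    norm_num
  · exact Finset.sum_eq_zero fun j _ => if_neg fun hj => hk hj.1

open Classical in
theorem sum_isParent_symm {h : ℕ} (x : TreeNode h) (k : Fin (h + 1)) :
    (∑ i : Fin (2 ^ (k : ℕ)), if TreeNode.IsParent ⟨k, i⟩ x then (1 : ℝ) else 0) =
      if (x.1 : ℕ) = k + 1 then 1 else 0 := by
  obtain ⟨l, i⟩ := x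
  split_ifs with hk
  · change (l : ℕ) = k + 1 at hk
    have hi := i.2
    have h2 : 2 ^ (l : ℕ) = 2 * 2 ^ (k : ℕ) := by rw [hk, pow_succ]; ring
    have ha : (i : ℕ) / 2 < 2 ^ (k : ℕ) := by omega
    rw [Finset.sum_eq_single ⟨(i : ℕ) / 2, ha⟩]
    · exact if_pos ⟨hk, rfl⟩
    · intro j _ hj
      rw [if_neg]
      rintro ⟨_, hj'⟩
      exact hj (Fin.ext hj'.symm)
    · simp
  · exact Finset.sum_eq_zero fun j _ => if_neg fun hj => hk hj.1

/-- Guarantees that the two cycle neighbours of a leaf are distinct, so that each leaf has exactly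
two. -/
theorem finRotate_ne_self {m : ℕ} (hm : 2 ≤ m) (j : Fin m) : finRotate m j ≠ j := by
  obtain ⟨m, rfl⟩ : ∃ m', m = m' + 2 := ⟨m - 2, by omega⟩
  intro hj
  have h1 := coe_finRotate j
  rw [hj] at h1
  split_ifs at h1 with h2
  · rw [h2] at h1
    simp at h1
  · omega

theorem TreeNode.leaf_inj {h : ℕ} {i j : Fin (2 ^ h)} :
    TreeNode.leaf h i = TreeNode.leaf h j ↔ i = j := by
  simp [TreeNode.leaf]

theorem TreeNode.exists_leaf {h : ℕ} {x : TreeNode h} (hx : x.1 = Fin.last h) :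
    ∃ i, x = TreeNode.leaf h i := by
  obtain ⟨k, i⟩ := x
  obtain rfl : k = Fin.last h := hx
  exact ⟨i, rfl⟩

open Classical in
theorem sum_leaf_ite {h : ℕ} (P : TreeNode h → Prop) (a b : Fin (2 ^ h)) (hab : a ≠ b)
    (hP : ∀ y, P y ↔ y = TreeNode.leaf h a ∨ y = TreeNode.leaf h b) (k : Fin (h + 1)) :
    (∑ i : Fin (2 ^ (k : ℕ)), if P ⟨k, i⟩ then (1 : ℝ) else 0) =
      if k = Fin.last h then 2 else 0 := by
  split_ifs with hk
  · subst hk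
    have : ∀ i : Fin (2 ^ h), P ⟨Fin.last h, i⟩ ↔ i = a ∨ i = b := by
      intro i
      rw [hP, ← TreeNode.leaf_inj, ← TreeNode.leaf_inj]
      rfl
    change (∑ i : Fin (2 ^ h), if P ⟨Fin.last h, i⟩ then (1 : ℝ) else 0) = 2
    simp only [this]
    rw [← Finset.sum_filter, Finset.filter_or, Finset.filter_eq', Finset.filter_eq']
    simp only [Finset.mem_univ, if_true]
    rw [← Finset.insert_eq, Finset.sum_pair hab]
    norm_num
  · refine Finset.sum_eq_zero fun i _ => if_neg fun hi => hk ?_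
    rcases (hP _).mp hi with h1 | h1 <;> exact congrArg Sigma.fst h1

-- The count does not involve `σ` and `ρ`: this is why the result holds for every gluing cycle.
open Classical in
theorem sum_gluedRel_inl {h : ℕ} (hh : 1 ≤ h) (σ ρ : Equiv.Perm (Fin (2 ^ h))) (x : TreeNode h)
    (k : Fin (h + 1)) :
    (∑ i : Fin (2 ^ (k : ℕ)), if gluedRel h σ ρ (.inl x) (.inr ⟨k, i⟩) then (1 : ℝ) else 0) =
      if x.1 = Fin.last h ∧ k = Fin.last h then 2 else 0 := by
  by_cases hx : x.1 = Fin.last h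
  · obtain ⟨i, rfl⟩ := TreeNode.exists_leaf hx
    have hm : 2 ≤ 2 ^ h := by simpa using Nat.pow_le_pow_right (n := 2) (by norm_num) hh
    simp only [hx, true_and]
    refine sum_leaf_ite (fun y => gluedRel h σ ρ (.inl (TreeNode.leaf h i)) (.inr y))
      (ρ (σ.symm i)) (ρ ((finRotate _).symm (σ.symm i))) ?_ ?_ k
    · intro he
      have := finRotate_ne_self hm ((finRotate _).symm (σ.symm i))
      rw [Equiv.apply_symm_apply] at this
      exact this (ρ.injective he)
    · intro y
      simp only [gluedRel, TreeNode.leaf_inj]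
      constructor
      · rintro ⟨j, rfl, rfl | rfl⟩ <;> simp
      · rintro (rfl | rfl)
        · exact ⟨_, rfl, Or.inl (by simp)⟩
        · exact ⟨_, rfl, Or.inr (by simp)⟩
  · rw [if_neg (fun hc => hx hc.1)]
    refine Finset.sum_eq_zero fun i _ => if_neg ?_
    rintro ⟨j, -, rfl | rfl⟩ <;> exact hx rfl

open Classical in
theorem sum_gluedRel_inr {h : ℕ} (hh : 1 ≤ h) (σ ρ : Equiv.Perm (Fin (2 ^ h))) (x : TreeNode h)
    (k : Fin (h + 1)) :
    (∑ i : Fin (2 ^ (k : ℕ)), if gluedRel h σ ρ (.inl ⟨k, i⟩) (.inr x) then (1 : ℝ) else 0) =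
      if x.1 = Fin.last h ∧ k = Fin.last h then 2 else 0 := by
  by_cases hx : x.1 = Fin.last h
  · obtain ⟨i, rfl⟩ := TreeNode.exists_leaf hx
    have hm : 2 ≤ 2 ^ h := by simpa using Nat.pow_le_pow_right (n := 2) (by norm_num) hh
    simp only [hx, true_and]
    refine sum_leaf_ite (fun y => gluedRel h σ ρ (.inl y) (.inr (TreeNode.leaf h i)))
      (σ (ρ.symm i)) (σ (finRotate _ (ρ.symm i))) ?_ ?_ k
    · intro he
      exact finRotate_ne_self hm _ (σ.injective he).symm
    · intro y
      simp only [gluedRel, TreeNode.leaf_inj]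
      constructor
      · rintro ⟨j, rfl, hj⟩
        simpa using hj
      · intro hy
        exact ⟨ρ.symm i, by simp, hy⟩
  · rw [if_neg (fun hc => hx hc.1)]
    refine Finset.sum_eq_zero fun i _ => if_neg ?_
    rintro ⟨j, rfl, -⟩
    exact hx rfl

theorem TreeNode.IsParent.ne {h : ℕ} {u v : TreeNode h} (huv : u.IsParent v) : u ≠ v := by
  rintro rfl
  have := huv.1
  omega

theorem TreeNode.IsParent.asymm {h : ℕ} {u v : TreeNode h} (huv : u.IsParent v) :
    ¬ v.IsParent u := by
  intro hvu
  have h1 := huv.1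
  have h2 := hvu.1
  omega

open Classical in
/-- The number of neighbours of a vertex on each level of its own tree. -/
theorem sum_adj_tree {h : ℕ} (x : TreeNode h) (k : Fin (h + 1)) :
    (∑ i : Fin (2 ^ (k : ℕ)),
      if x.IsParent ⟨k, i⟩ ∨ TreeNode.IsParent ⟨k, i⟩ x then (1 : ℝ) else 0) =
      (if (k : ℕ) = x.1 + 1 then 2 else 0) + if (x.1 : ℕ) = k + 1 then 1 else 0 := by
  rw [← sum_isParent, ← sum_isParent_symm, ← Finset.sum_add_distrib]
  refine Finset.sum_congr rfl fun i _ => ?_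
  by_cases h1 : x.IsParent ⟨k, i⟩
  · simp [h1, h1.asymm]
  · simp [h1]

theorem gluedTrees_adj_inl_inl {h : ℕ} (σ ρ : Equiv.Perm (Fin (2 ^ h))) (x y : TreeNode h) :
    (gluedTrees h σ ρ).Adj (.inl x) (.inl y) ↔ x.IsParent y ∨ y.IsParent x := by
  simp only [gluedTrees, SimpleGraph.fromRel_adj, gluedRel, ne_eq, Sum.inl.injEq,
    and_iff_right_iff_imp]
  rintro (h1 | h1)
  · exact h1.ne
  · exact h1.ne.symm

theorem gluedTrees_adj_inr_inr {h : ℕ} (σ ρ : Equiv.Perm (Fin (2 ^ h))) (x y : TreeNode h) :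
    (gluedTrees h σ ρ).Adj (.inr x) (.inr y) ↔ x.IsParent y ∨ y.IsParent x := by
  simp only [gluedTrees, SimpleGraph.fromRel_adj, gluedRel, ne_eq, Sum.inr.injEq,
    and_iff_right_iff_imp]
  rintro (h1 | h1)
  · exact h1.ne
  · exact h1.ne.symm

theorem gluedTrees_adj_inl_inr {h : ℕ} (σ ρ : Equiv.Perm (Fin (2 ^ h))) (x y : TreeNode h) :
    (gluedTrees h σ ρ).Adj (.inl x) (.inr y) ↔ gluedRel h σ ρ (.inl x) (.inr y) := by
  rw [gluedTrees, SimpleGraph.fromRel_adj]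
  simp [gluedRel]

theorem gluedTrees_adj_inr_inl {h : ℕ} (σ ρ : Equiv.Perm (Fin (2 ^ h))) (x y : TreeNode h) :
    (gluedTrees h σ ρ).Adj (.inr x) (.inl y) ↔ gluedRel h σ ρ (.inl y) (.inr x) := by
  rw [SimpleGraph.adj_comm, gluedTrees_adj_inl_inr]

/-- Two children or one parent, the normalisations √2^level and the jump rate 1/√2 combine to weight
1 in both directions. -/
theorem level_weight_identity {h : ℕ} (k l : Fin (h + 1)) (a : ℝ) :
    1 / √2 * (((if (l : ℕ) = k + 1 then 2 else 0) + if (k : ℕ) = l + 1 then 1 else 0) *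
      (a / √2 ^ (l : ℕ))) = levelWeight k l * a / √2 ^ (k : ℕ) := by
  have hr : √2 * √2 = 2 := Real.mul_self_sqrt (by norm_num)
  have hr0 : √2 ≠ 0 := by positivity
  unfold levelWeight
  by_cases h1 : (l : ℕ) = k + 1
  · simp only [h1, if_true, true_or]
    rw [if_neg (by omega), pow_succ]
    field_simp
    linear_combination -a * hr
  · by_cases h2 : (k : ℕ) = l + 1
    · simp only [h2, if_true, or_true]
      rw [if_neg (by omega), pow_succ]
      field_simp
      ring
    · simp [h1, h2]

theorem cross_weight_identity {h : ℕ} (k l : Fin (h + 1)) (a : ℝ) :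
    1 / √2 * ((if k = Fin.last h ∧ l = Fin.last h then 2 else 0) * (a / √2 ^ (l : ℕ))) =
      (if k = Fin.last h ∧ l = Fin.last h then √2 else 0) * a / √2 ^ (k : ℕ) := by
  have hr : √2 * √2 = 2 := Real.mul_self_sqrt (by norm_num)
  have hr0 : √2 ≠ 0 := by positivity
  split_ifs with h1
  · obtain ⟨rfl, rfl⟩ := h1
    field_simp
    linear_combination -a * hr
  · simp

open Classical in
theorem walkHamiltonian_mulVec_columnLift {h : ℕ} (hh : 1 ≤ h) (σ ρ : Equiv.Perm (Fin (2 ^ h)))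
    (φ : Column h → ℝ) :
    (walkHamiltonian (gluedTrees h σ ρ) (1 / √2)).mulVec (columnLift φ) =
      columnLift ((columnMatrix h).mulVec φ) := by
  have key : ∀ x : GluedVertex h, 1 / √2 * ∑ y : GluedVertex h,
      (if (gluedTrees h σ ρ).Adj x y then (1 : ℝ) else 0) * (φ y.column / √2 ^ y.column.level) =
      (columnMatrix h).mulVec φ x.column / √2 ^ x.column.level := by
    intro x
    simp only [Matrix.mulVec, dotProduct, Fintype.sum_sum_type, Fintype.sum_sigma,
      GluedVertex.column, Column.level, Sum.map_inl, Sum.map_inr, Sum.elim_inl, Sum.elim_inr,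
      ← Finset.sum_mul, mul_add, add_div, Finset.mul_sum, Finset.sum_div]
    rcases x with x | x
    · simp only [gluedTrees_adj_inl_inl, gluedTrees_adj_inl_inr, sum_adj_tree,
        sum_gluedRel_inl hh, level_weight_identity, cross_weight_identity, columnMatrix,
        Sum.map_inl, Sum.elim_inl]
    · simp only [gluedTrees_adj_inr_inl, gluedTrees_adj_inr_inr, sum_adj_tree,
        sum_gluedRel_inr hh, level_weight_identity, cross_weight_identity, columnMatrix,
        Sum.map_inr, Sum.elim_inr]
  funext x
  rw [columnLift, ← key x]
  simp only [walkHamiltonian, Matrix.mulVec, dotProduct, Matrix.smul_apply,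
    SimpleGraph.adjMatrix_apply, columnLift, smul_eq_mul]
  push_cast
  rw [Finset.mul_sum]
  refine Finset.sum_congr rfl fun y _ => ?_
  split_ifs <;> simp

/-! ### Evolution of eigenvectors and the spectrum of the column matrix. -/

theorem Matrix.exp_smul_mulVec_of_mulVec_eq_smul {V : Type*} [Fintype V] [DecidableEq V]
    {M : Matrix V V ℂ} {v : V → ℂ} {μ : ℂ} (hv : M.mulVec v = μ • v) (c : ℂ) :
    (NormedSpace.exp (c • M)).mulVec v = Complex.exp (c * μ) • v := by
  -- A submultiplicative norm is chosen only to sum the exponential series.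
  let _ : NormedRing (Matrix V V ℂ) := Matrix.linftyOpNormedRing
  let _ : NormedAlgebra ℂ (Matrix V V ℂ) := Matrix.linftyOpNormedAlgebra
  have hpow : ∀ k : ℕ, ((c • M) ^ k).mulVec v = (c * μ) ^ k • v := by
    intro k
    induction k with
    | zero => simp
    | succ k ih =>
      rw [pow_succ, ← Matrix.mulVec_mulVec, Matrix.smul_mulVec, hv, smul_smul,
        Matrix.mulVec_smul, ih, smul_smul, pow_succ, mul_comm]
  have h1 := NormedSpace.exp_series_hasSum_exp' (𝕂 := ℂ) (c • M)
  have h2 : HasSum (fun k : ℕ => (((k.factorial : ℂ)⁻¹ • (c • M) ^ k)).mulVec v)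
      ((NormedSpace.exp (c • M)).mulVec v) :=
    h1.map (Matrix.mulVecBilin ℂ ℂ |>.flip v).toAddMonoidHom
      (Continuous.matrix_mulVec continuous_id continuous_const)
  have h3 : HasSum (fun k : ℕ => ((k.factorial : ℂ)⁻¹ • (c * μ) ^ k) • v)
      (Complex.exp (c * μ) • v) := by
    rw [Complex.exp_eq_exp_ℂ]
    exact (NormedSpace.exp_series_hasSum_exp' (𝕂 := ℂ) (c * μ)).smul_const v
  refine h2.unique ?_
  convert h3 using 2 with k
  rw [Matrix.smul_mulVec, hpow, smul_smul, smul_eq_mul]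

theorem sum_levelWeight_mul {h : ℕ} (k : Fin (h + 1)) (f : Fin (h + 1) → ℝ) :
    ∑ l, levelWeight k l * f l =
      (if hk : (k : ℕ) + 1 < h + 1 then f ⟨k + 1, hk⟩ else 0) +
        if 0 < (k : ℕ) then f ⟨k - 1, by omega⟩ else 0 := by
  have hsplit : ∀ l : Fin (h + 1), levelWeight k l * f l =
      (if (l : ℕ) = k + 1 then f l else 0) + if (k : ℕ) = l + 1 then f l else 0 := by
    intro l
    unfold levelWeight
    by_cases h1 : (l : ℕ) = k + 1
    · simp only [h1, true_or, if_true, one_mul]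
      rw [if_neg (by omega), add_zero]
    · simp [h1]
  rw [Finset.sum_congr rfl fun l _ => hsplit l, Finset.sum_add_distrib]
  congr 1
  · split_ifs with hk
    · rw [Finset.sum_eq_single ⟨k + 1, hk⟩]
      · simp
      · intro l _ hl
        exact if_neg fun hl' => hl (Fin.ext hl')
      · simp
    · exact Finset.sum_eq_zero fun l _ => if_neg (by omega)
  · split_ifs with hk
    · rw [Finset.sum_eq_single ⟨k - 1, by omega⟩]
      · exact if_pos (by simp; omega)
      · intro l _ hl
        exact if_neg fun hl' => hl (Fin.ext (by simp; omega))
      · simp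
    · exact Finset.sum_eq_zero fun l _ => if_neg (by omega)

/-- A solution of the eigenvalue equation on one side is a multiple of `jacobiSeq`. -/
theorem eq_mul_jacobiSeq {h : ℕ} {E : ℝ} {f : Fin (h + 1) → ℝ}
    (hf : ∀ k : Fin (h + 1), (k : ℕ) < h → ∑ l, levelWeight k l * f l = E * f k) :
    ∀ k : Fin (h + 1), f k = f 0 * jacobiSeq E (k + 1) := by
  have : ∀ (m : ℕ) (hm : m < h + 1), f ⟨m, hm⟩ = f 0 * jacobiSeq E (m + 1) := by
    intro m
    induction m using Nat.twoStepInduction with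
    | zero => intro hm; simp [jacobiSeq]
    | one =>
      intro hm
      have h1 := hf 0 (by simp; omega)
      rw [sum_levelWeight_mul, dif_pos (by simp; omega)] at h1
      simp only [Fin.coe_ofNat_eq_mod, Nat.zero_mod, lt_irrefl, if_false, add_zero, zero_add] at h1
      rw [h1, jacobiSeq_add_two]
      simp [jacobiSeq]
      ring
    | more m ih1 ih2 =>
      intro hm
      have h1 := hf ⟨m + 1, by omega⟩ (by simp; omega)
      rw [sum_levelWeight_mul, dif_pos (by simp; omega), if_pos (by simp)] at h1
      simp only [Nat.add_sub_cancel] at h1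
      rw [ih1 (by omega), ih2 (by omega)] at h1
      rw [jacobiSeq_add_two]
      linear_combination h1
  exact fun k => this k k.2

theorem sum_levelWeight_last {h : ℕ} (hh : 1 ≤ h) (E a : ℝ) :
    ∑ l : Fin (h + 1), levelWeight (Fin.last h) l * (a * jacobiSeq E (l + 1)) =
      a * jacobiSeq E h := by
  rw [sum_levelWeight_mul, dif_neg (by simp), if_pos (by simp; omega)]
  simp [Nat.sub_add_cancel hh]

/-- The shape of the eigenvectors of the column matrix. -/
theorem columnMatrix_eigenvector {h : ℕ} (hh : 1 ≤ h) {E : ℝ} {φ : Column h → ℝ} (hφ : φ ≠ 0)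
    (hE : (columnMatrix h).mulVec φ = E • φ) :
    ∃ s, IsSectorEigenvalue (h + 1) s E ∧ φ (.inl 0) ≠ 0 ∧
      (∀ k : Fin (h + 1), φ (.inl k) = φ (.inl 0) * jacobiSeq E (k + 1)) ∧
      ∀ k : Fin (h + 1), φ (.inr k) = s * φ (.inl 0) * jacobiSeq E (k + 1) := by
  have hl : ∀ k : Fin (h + 1), (∑ l, levelWeight k l * φ (.inl l)) +
      (if k = Fin.last h then √2 * φ (.inr (Fin.last h)) else 0) = E * φ (.inl k) := by
    intro k
    have := congrFun hE (.inl k)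
    simp only [Matrix.mulVec, dotProduct, Fintype.sum_sum_type, columnMatrix, Pi.smul_apply,
      smul_eq_mul] at this
    rw [← this]
    congr 1
    by_cases hk : k = Fin.last h <;> simp [hk]
  have hr : ∀ k : Fin (h + 1), (∑ l, levelWeight k l * φ (.inr l)) +
      (if k = Fin.last h then √2 * φ (.inl (Fin.last h)) else 0) = E * φ (.inr k) := by
    intro k
    have := congrFun hE (.inr k)
    simp only [Matrix.mulVec, dotProduct, Fintype.sum_sum_type, columnMatrix, Pi.smul_apply,
      smul_eq_mul] at this
    rw [← this, add_comm]
    congr 1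
    by_cases hk : k = Fin.last h <;> simp [hk]
  have hne : ∀ k : Fin (h + 1), (k : ℕ) < h → k ≠ Fin.last h := by
    rintro k hk rfl
    simp at hk
  have hL := eq_mul_jacobiSeq (f := fun k => φ (.inl k)) (E := E) fun k hk => by
    simpa [hne k hk] using hl k
  have hR := eq_mul_jacobiSeq (f := fun k => φ (.inr k)) (E := E) fun k hk => by
    simpa [hne k hk] using hr k
  have hl' := hl (Fin.last h)
  have hr' := hr (Fin.last h)
  have hLsum := sum_levelWeight_last hh E (φ (.inl 0))
  have hRsum := sum_levelWeight_last hh E (φ (.inr 0))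
  rw [Finset.sum_congr rfl fun l _ => congrArg (levelWeight (Fin.last h) l * ·) (hL l).symm]
    at hLsum
  rw [Finset.sum_congr rfl fun l _ => congrArg (levelWeight (Fin.last h) l * ·) (hR l).symm]
    at hRsum
  have hLlast := hL (Fin.last h)
  have hRlast := hR (Fin.last h)
  simp only [Fin.val_last] at hLlast hRlast
  rw [hLsum, if_pos rfl, hLlast, hRlast] at hl'
  rw [hRsum, if_pos rfl, hLlast, hRlast] at hr'
  set a := φ (.inl 0)
  set b := φ (.inr 0)
  have hrec := jacobiSeq_add_two E h
  have e1 : a * jacobiSeq E (h + 2) = √2 * b * jacobiSeq E (h + 1) := by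
    rw [hrec]; linear_combination -hl'
  have e2 : b * jacobiSeq E (h + 2) = √2 * a * jacobiSeq E (h + 1) := by
    rw [hrec]; linear_combination -hr'
  have hr2 : √2 ^ 2 = 2 := Real.sq_sqrt (by norm_num)
  have hr0 : √2 ≠ 0 := by positivity
  have hab0 : ¬ (a = 0 ∧ b = 0) := by
    rintro ⟨ha, hb⟩
    apply hφ
    funext c
    rcases c with k | k
    · exact (hL k).trans (by rw [ha]; simp)
    · exact (hR k).trans (by rw [hb]; simp)
  have henergy := jacobiSeq_energy E (h + 1)
  -- Otherwise `jacobiSeq E (h + 2)` is nonzero by the conserved form, and `e1`, `e2` kill both a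
  -- and b.
  have hu : jacobiSeq E (h + 1) ≠ 0 := by
    intro h0
    rw [h0] at e1 e2 henergy
    have hw : jacobiSeq E (h + 2) ≠ 0 := by
      intro h1
      rw [h1] at henergy
      norm_num at henergy
    simp [hw] at e1 e2
    exact hab0 ⟨e1, e2⟩
  -- Eliminating `jacobiSeq E (h + 2)` from `e1` and `e2` yields the parity directly, with no prior
  -- assumption that eigenvalues are simple.
  have hsq : (a - b) * (a + b) = 0 := by
    have : √2 * jacobiSeq E (h + 1) * ((a - b) * (a + b)) = 0 := by
      linear_combination b * e1 - a * e2
    rcases mul_eq_zero.mp this with h1 | h1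
    · exact absurd h1 (mul_ne_zero hr0 hu)
    · exact h1
  have ha : a ≠ 0 := by
    intro ha
    refine hab0 ⟨ha, ?_⟩
    rw [ha] at hsq
    simpa using hsq
  obtain ⟨s, hs, hbs⟩ : ∃ s : ℝ, (s = 1 ∨ s = -1) ∧ b = s * a := by
    rcases mul_eq_zero.mp hsq with h1 | h1
    · exact ⟨1, Or.inl rfl, by linarith⟩
    · exact ⟨-1, Or.inr rfl, by linarith⟩
  refine ⟨s, ⟨hs, ?_⟩, ha, hL, fun k => (hR k).trans (by rw [hbs])⟩
  apply mul_left_cancel₀ ha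
  rw [e1, hbs]
  ring

/-- The spectral decomposition of the column matrix, as seen from the two roots. -/
theorem exists_columnMatrix_spectral {h : ℕ} (hh : 100 ≤ h + 1) :
    ∃ (φ : Column h → Column h → ℝ) (E s : Column h → ℝ),
      (∀ k, (columnMatrix h).mulVec (φ k) = E k • φ k) ∧
      (∀ c, ∑ k, φ k (.inl 0) * φ k c = (Pi.single (.inl 0) 1 : Column h → ℝ) c) ∧
      (∀ k, |s k| = 1 ∧ φ k (.inr 0) = s k * φ k (.inl 0)) ∧
      ∀ k l, k ≠ l → 5 / ((h + 1 : ℕ) : ℝ) ^ 3 ≤ |E k - E l| := by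
  set hH := columnMatrix_isHermitian h
  set B := hH.eigenvectorBasis
  have hne : ∀ k, (B k).ofLp ≠ 0 := by
    intro k h0
    apply B.toBasis.ne_zero k
    rw [OrthonormalBasis.coe_toBasis]
    ext c
    rw [h0]
    rfl
  choose s hs ha hL hR using fun k =>
    columnMatrix_eigenvector (by omega) (hne k) (hH.mulVec_eigenvectorBasis k)
  refine ⟨fun k => (B k).ofLp, hH.eigenvalues, s, hH.mulVec_eigenvectorBasis, ?_, ?_, ?_⟩
  · intro c
    -- Parseval for the basis vectors at the left root and at `c`.
    have h1 := B.sum_inner_mul_inner (EuclideanSpace.single (.inl 0) 1) (EuclideanSpace.single c 1)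
    simp only [EuclideanSpace.inner_single_left, EuclideanSpace.inner_single_right] at h1
    simpa [Pi.single_apply, eq_comm] using h1
  · intro k
    refine ⟨?_, ?_⟩
    · rcases (hs k).parity with h1 | h1 <;> simp [h1]
    · have := hR k 0
      simpa [jacobiSeq] using this
  · intro k l hkl
    refine (hs k).gap (hs l) hh fun hskl => ?_
    -- For equal parities both halves contribute the same amount, so orthogonality passes to the
    -- half sums.
    have horth : inner ℝ (B k) (B l) = 0 := B.orthonormal.2 hkl
    have hsum : ∑ c, (B k).ofLp c * (B l).ofLp c = 0 := by
      rw [PiLp.inner_apply] at horth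
      simpa [mul_comm] using horth
    rw [Fintype.sum_sum_type, ← Finset.sum_add_distrib] at hsum
    have hterm : ∀ j : Fin (h + 1),
        (B k).ofLp (.inl j) * (B l).ofLp (.inl j) + (B k).ofLp (.inr j) * (B l).ofLp (.inr j) =
        2 * (B k).ofLp (.inl 0) * (B l).ofLp (.inl 0) *
          (jacobiSeq (hH.eigenvalues k) (j + 1) * jacobiSeq (hH.eigenvalues l) (j + 1)) := by
      intro j
      rw [hL k j, hL l j, hR k j, hR l j, ← hskl]
      linear_combination ((B k).ofLp (.inl 0) * (B l).ofLp (.inl 0) *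
        (jacobiSeq (hH.eigenvalues k) (j + 1) * jacobiSeq (hH.eigenvalues l) (j + 1))) *
          (hs k).sq_parity
    rw [Finset.sum_congr rfl fun j _ => hterm j, ← Finset.mul_sum] at hsum
    rw [Finset.sum_range]
    refine (mul_eq_zero.mp hsum).resolve_left ?_
    exact mul_ne_zero (mul_ne_zero two_ne_zero (ha k)) (ha l)

/-! ### The amplitude at the exit and the conclusion. -/

theorem columnLift_single_root (h : ℕ) :
    columnLift (Pi.single (.inl 0) 1 : Column h → ℝ) = Pi.single (entranceVertex h) 1 := by
  classical
  funext x
  by_cases hx : x = entranceVertex h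
  · subst hx
    simp [columnLift, entranceVertex, GluedVertex.column, Column.level, TreeNode.root]
  · have : x.column ≠ .inl 0 := by
      intro hc
      apply hx
      rcases x with ⟨k, i⟩ | x
      · obtain rfl : k = 0 := Sum.inl_injective hc
        have hi := i.2
        simp only [Fin.coe_ofNat_eq_mod, Nat.zero_mod, pow_zero] at hi
        simp only [entranceVertex, TreeNode.root, Sum.inl.injEq, Sigma.mk.injEq, heq_eq_eq,
          true_and]
        exact Fin.ext (by simp; omega)
      · cases hc
    simp [columnLift, this, hx]

theorem columnLift_sum {h : ℕ} {K : Type*} [Fintype K] (a : K → ℝ) (φ : K → Column h → ℝ) :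
    columnLift (fun c => ∑ k, a k * φ k c) = ∑ k, (a k : ℂ) • columnLift (φ k) := by
  funext x
  simp only [columnLift, Finset.sum_apply, Pi.smul_apply, smul_eq_mul, Finset.sum_div]
  push_cast
  exact Finset.sum_congr rfl fun k _ => by ring

theorem columnLift_smul {h : ℕ} (a : ℝ) (φ : Column h → ℝ) :
    columnLift (a • φ) = (a : ℂ) • columnLift φ := by
  funext x
  simp [columnLift, mul_div_assoc]

theorem columnLift_exitVertex {h : ℕ} (φ : Column h → ℝ) :
    columnLift φ (exitVertex h) = φ (.inr 0) := by
  simp [columnLift, exitVertex, GluedVertex.column, Column.level, TreeNode.root]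

/-- The transition amplitude from the entrance to the exit. -/
theorem exists_walkState_exit_eq {h : ℕ} (hh : 100 ≤ h + 1) (σ ρ : Equiv.Perm (Fin (2 ^ h))) :
    ∃ w E : Column h → ℝ, ∑ k, |w k| = 1 ∧
      (∀ k l, k ≠ l → 5 / ((h + 1 : ℕ) : ℝ) ^ 3 ≤ |E k - E l|) ∧
      ∀ t : ℝ, walkState (gluedTrees h σ ρ) (1 / √2) (entranceVertex h) t (exitVertex h) =
        ∑ k, (w k : ℂ) * Complex.exp (-(Complex.I * t) * E k) := by
  classical
  obtain ⟨φ, E, s, hφ, hsum, hs, hgap⟩ := exists_columnMatrix_spectral hh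
  -- Parity turns the product of the two root amplitudes into a signed square, so the |w k| sum to
  -- the squared norm of the root state.
  refine ⟨fun k => s k * φ k (.inl 0) ^ 2, E, ?_, hgap, fun t => ?_⟩
  · have := hsum (.inl 0)
    rw [Pi.single_eq_same] at this
    rw [← this]
    refine Finset.sum_congr rfl fun k _ => ?_
    rw [abs_mul, (hs k).1, one_mul, abs_of_nonneg (sq_nonneg _), sq]
  · have hent : (Pi.single (entranceVertex h) 1 : GluedVertex h → ℂ) =
        ∑ k, (φ k (.inl 0) : ℂ) • columnLift (φ k) := by
      rw [← columnLift_single_root, ← columnLift_sum]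
      congr 1
      exact (funext hsum).symm
    have heig : ∀ k, (walkHamiltonian (gluedTrees h σ ρ) (1 / √2)).mulVec (columnLift (φ k)) =
        (E k : ℂ) • columnLift (φ k) := by
      intro k
      rw [walkHamiltonian_mulVec_columnLift (by omega), hφ, columnLift_smul]
    have hstate : walkState (gluedTrees h σ ρ) (1 / √2) (entranceVertex h) t =
        ∑ k, (φ k (.inl 0) : ℂ) •
          (Complex.exp (-(Complex.I * t) * E k) • columnLift (φ k)) := by
      unfold walkState
      have hsingle : ∀ inst : DecidableEq (GluedVertex h),
          (@Pi.single _ (fun _ => ℂ) _ inst (entranceVertex h) 1 : GluedVertex h → ℂ) =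
            ∑ k, (φ k (.inl 0) : ℂ) • columnLift (φ k) := by
        intro inst
        convert hent
      rw [hsingle, Matrix.mulVec_sum]
      refine Finset.sum_congr rfl fun k _ => ?_
      rw [Matrix.mulVec_smul]
      exact congrArg _ (@Matrix.exp_smul_mulVec_of_mulVec_eq_smul _ _ (_) _ _ _ (heig k) _)
    rw [hstate, Finset.sum_apply]
    refine Finset.sum_congr rfl fun k _ => ?_
    simp only [Pi.smul_apply, smul_eq_mul, columnLift_exitVertex, (hs k).2]
    push_cast
    ring

theorem theorem1 :
    ∃ N : ℕ, 1 ≤ N ∧ ∀ n : ℕ, N ≤ n → ∀ σ ρ : Equiv.Perm (Fin (2 ^ (n - 1))), ∀ ε : ℝ, 0 < ε →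
      1 / (2 * (n : ℝ)) * (1 - ε) <
        walkHittingProb (gluedTrees (n - 1) σ ρ) (1 / √2)
          (entranceVertex (n - 1)) (exitVertex (n - 1)) ((n : ℝ) ^ 4 / (2 * ε)) := by
  refine ⟨100, by norm_num, fun n hn σ ρ ε hε => ?_⟩
  obtain ⟨w, E, hw, hgap, hamp⟩ := exists_walkState_exit_eq (h := n - 1) (by omega) σ ρ
  rw [Nat.sub_add_cancel (by omega)] at hgap
  have hn0 : (0 : ℝ) < n := by exact_mod_cast (by omega : 0 < n)
  have hδ : 0 < 5 / (n : ℝ) ^ 3 := by positivity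
  have hτ : 0 < (n : ℝ) ^ 4 / (2 * ε) := by positivity
  have hmain := le_average_normSq_sum_exp w E hw hδ hτ hgap
  simp only [walkHittingProb, hamp]
  refine lt_of_lt_of_le ?_ hmain
  have hcard : (Fintype.card (Column (n - 1)) : ℝ) = 2 * n := by
    rw [Fintype.card_sum, Fintype.card_fin, Nat.sub_add_cancel (by omega)]
    push_cast
    ring
  rw [hcard, mul_sub, mul_one]
  -- The constant 5 in the gap makes the error 4/5 of the allowed ε/(2n), which gives the strict
  -- inequality; any constant above 4 would do.
  have h1 : 1 / ((n : ℝ) ^ 4 / (2 * ε) * (5 / (n : ℝ) ^ 3)) = 4 / 5 * (1 / (2 * (n : ℝ)) * ε) := by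
    field_simp
    norm_num
  have h2 : 0 < 1 / (2 * (n : ℝ)) * ε := by positivity
  rw [h1]
  linarith
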